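/- Let $M_2\subseteq\mathbb{Z}$ and let $\mathbb{V}(\mathbb{Z},M_2)$ be the strip $\{(x,y)\in\mathbb{R}^2 : 0\le y\le 1\}$ with marked points $(i,0)$, $i\in\mathbb{Z}$, and $(u,1)$, $u\in M_2$. An arc is a non-contractible curve in the strip joining two marked points, considered up to isotopy fixing its endpoints; boundary segments joining two consecutive marked points of the same boundary line are not arcs. An arc is peripheral if its endpoints lie on the same boundary line. Two arcs are compatible if they have representatives which do not meet except possibly at common endpoints. Let $T$ be a triangulation of $\mathbb{V}(\mathbb{Z},M_2)$, that is, a maximal collection of pairwise compatible arcs. Assume that $T$ is admissible, that is, every marked point $(i,0)$ is incident with only finitely many arcs of $T$, and that every marked point $(u,1)$ with $u\in M_2$ is incident with at least one arc of $T$. An infinite frieze is a map $t:\mathbb{Z}\times\mathbb{Z}\to\mathbb{Z}$ such that, for all $i,j\in\mathbb{Z}$: $t(i,i)=0$; $t(i,j)\ge 1$ if $i<j$; $t(i,i+1)=1$; $t(i,j)=-t(j,i)$; and $t(i,j)\,t(i+1,j+1)-t(i,j+1)\,t(i+1,j)=1$. Then each $(i,0)$ is incident with finitely many triangles of $T$ (their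 sides being arcs of $T$ or boundary segments), and there is a unique infinite frieze $t=\Phi(T)$ such that, for every $i\in\mathbb{Z}$, $t(i-1,i+1)$ is the number of triangles of $T$ incident with $(i,0)$. Moreover, for all $i,j\in\mathbb{Z}$ with $i\le j$, $t(i,j)=1$ if and only if $j=i+1$ or $T$ contains a peripheral arc from $(i,0)$ to $(j,0)$. -/

import Mathlib

open Set

namespace InfiniteStrip

/-- The infinite strip of height one in the plane, boundary lines included. -/
abbrev Strip : Type := {p : ℝ × ℝ // 0 ≤ p.2 ∧ p.2 ≤ 1}

/-- The marked points of the strip `𝕍(ℤ, M₂)`: one point `lower i` for each integer `i`, and one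
point `upper u` for each `u ∈ M₂`. -/
inductive MarkedPoint (M₂ : Set ℤ) : Type
  | lower (i : ℤ) : MarkedPoint M₂
  | upper (u : M₂) : MarkedPoint M₂

/-- The position of a marked point: `lower i` is `(i, 0)` and `upper u` is `(u, 1)`. -/
def MarkedPoint.pos {M₂ : Set ℤ} : MarkedPoint M₂ → Strip
  | .lower i => ⟨((i : ℝ), 0), le_refl (0 : ℝ), zero_le_one⟩
  | .upper u => ⟨(((u : ℤ) : ℝ), 1), zero_le_one, le_refl (1 : ℝ)⟩

/-- A simple curve in the strip whose relative interior lies in the open strip. -/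
def IsSimpleCurve {p q : Strip} (γ : Path p q) : Prop :=
  Function.Injective γ ∧
    ∀ s : unitInterval, s ≠ 0 → s ≠ 1 → 0 < (γ s : ℝ × ℝ).2 ∧ (γ s : ℝ × ℝ).2 < 1

/-- Two curves with the same endpoints in the strip are always homotopic relative to their
endpoints: the class of a curve in the strip is determined by its two endpoints. -/
theorem curves_homotopic {p q : Strip} (γ δ : Path p q) : γ.Homotopic δ := by
  have hc : Convex ℝ {x : ℝ × ℝ | 0 ≤ x.2 ∧ x.2 ≤ 1} := by
    intro x hx y hy a b ha hb hab
    simp only [mem_ofPred_eq, Prod.snd_add, Prod.smul_snd, smul_eq_mul] at *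
    constructor <;> nlinarith [mul_nonneg ha hx.1, mul_nonneg hb hy.1,
      mul_nonneg ha (sub_nonneg.2 hx.2), mul_nonneg hb (sub_nonneg.2 hy.2)]
  have : ContractibleSpace Strip :=
    hc.contractibleSpace ⟨((0 : ℝ), (0 : ℝ)), le_refl (0 : ℝ), zero_le_one⟩
  exact SimplyConnectedSpace.paths_homotopic γ δ

/-- `P` and `Q` are consecutive marked points of the same boundary line (no marked point lies
strictly between them): they are joined by a boundary segment. -/
def IsBoundarySegment {M₂ : Set ℤ} : MarkedPoint M₂ → MarkedPoint M₂ → Prop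
  | .lower i, .lower j => i ⋖ j ∨ j ⋖ i
  | .upper u, .upper v => u ⋖ v ∨ v ⋖ u
  | _, _ => False

/-- Arcs are considered up to isotopy fixing the endpoints and without orientation, so an arc is
recorded by the unordered pair of its endpoints. A pair of marked points is an arc when the curves
joining them are non-contractible: the two points are distinct, and they do not cut out a boundary
segment. -/
def IsArc {M₂ : Set ℤ} (e : Sym2 (MarkedPoint M₂)) : Prop :=
  ∃ P Q : MarkedPoint M₂, e = s(P, Q) ∧ P ≠ Q ∧ ¬ IsBoundarySegment P Q

/-- Two arcs are compatible if they have representatives (simple curves in the strip) that do not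
meet, except maybe at common endpoints. -/
def Compatible {M₂ : Set ℤ} (e f : Sym2 (MarkedPoint M₂)) : Prop :=
  ∃ (P Q R S : MarkedPoint M₂) (γ : Path P.pos Q.pos) (δ : Path R.pos S.pos),
    e = s(P, Q) ∧ f = s(R, S) ∧ IsSimpleCurve γ ∧ IsSimpleCurve δ ∧
      ∀ s t : unitInterval, γ s = δ t → (s = 0 ∨ s = 1) ∧ (t = 0 ∨ t = 1)

/-- A triangulation is a maximal collection of pairwise compatible arcs. -/
def IsTriangulation {M₂ : Set ℤ} (T : Set (Sym2 (MarkedPoint M₂))) : Prop :=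
  Maximal (fun S : Set (Sym2 (MarkedPoint M₂)) => (∀ e ∈ S, IsArc e) ∧ S.Pairwise Compatible) T

/-- Every lower marked point is incident with only finitely many arcs. -/
def IsAdmissible {M₂ : Set ℤ} (T : Set (Sym2 (MarkedPoint M₂))) : Prop :=
  ∀ i : ℤ, {e ∈ T | MarkedPoint.lower i ∈ e}.Finite

/-- A marked point is special if it is incident with no arc of `T`. -/
def IsSpecial {M₂ : Set ℤ} (T : Set (Sym2 (MarkedPoint M₂))) (P : MarkedPoint M₂) : Prop :=
  ∀ e ∈ T, P ∉ e

/-- The graph on the marked points whose edges are the arcs of `T` and the boundary segments. -/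
def sideGraph {M₂ : Set ℤ} (T : Set (Sym2 (MarkedPoint M₂))) : SimpleGraph (MarkedPoint M₂) where
  Adj P Q := P ≠ Q ∧ (IsBoundarySegment P Q ∨ s(P, Q) ∈ T)
  symm := ⟨by
    rintro P Q ⟨hne, h⟩
    refine ⟨hne.symm, h.imp (fun h => ?_) (fun h => Sym2.eq_swap ▸ h)⟩
    cases P <;> cases Q <;> simp only [IsBoundarySegment] at h ⊢ <;> tauto⟩
  loopless := ⟨fun _ h => h.1 rfl⟩

/-- The triangles of `T` incident with `P`: triples of marked points containing `P`, any two of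
which are joined by an arc of `T` or by a boundary segment. -/
def trianglesAt {M₂ : Set ℤ} (T : Set (Sym2 (MarkedPoint M₂))) (P : MarkedPoint M₂) :
    Set (Finset (MarkedPoint M₂)) :=
  {Δ | (sideGraph T).IsNClique 3 Δ ∧ P ∈ Δ}

/-- Infinite friezes, as fillings of the whole discrete plane. -/
structure IsInfiniteFrieze (t : ℤ → ℤ → ℤ) : Prop where
  diag : ∀ i, t i i = 0
  pos : ∀ i j, i < j → 1 ≤ t i j
  one : ∀ i, t i (i + 1) = 1
  antisymm : ∀ i j, t i j = -t j i
  unimodular : ∀ i j, t i j * t (i + 1) (j + 1) - t i (j + 1) * t (i + 1) j = 1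

/-- `t = Φ(T)`: `t` is the infinite frieze whose quiddity sequence `(t (i - 1) (i + 1))_i` is the
sequence of the numbers of triangles of `T` incident with the points `(i, 0)`. -/
def IsPhi {M₂ : Set ℤ} (T : Set (Sym2 (MarkedPoint M₂))) (t : ℤ → ℤ → ℤ) : Prop :=
  IsInfiniteFrieze t ∧ ∀ i : ℤ, (trianglesAt T (.lower i)).Finite ∧
    t (i - 1) (i + 1) = ((trianglesAt T (.lower i)).ncard : ℤ)

end InfiniteStrip

/-!
The strip is a half plane through `p ↦ exp (π p)`, and half circles realise arcs whose endpoints do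
not separate each other on the real line; conversely, curves with separating endpoints meet, since
otherwise a continuous choice of arguments would contradict the order of the endpoints. So a
triangulation is a maximal noncrossing graph on the real line, and a vertex of degree `d` lies on
`d - 1` triangles.

For the numbers `q k` of triangles incident with `(k, 0)`, each row `f = t i` of the frieze solves
`f (k + 1) + f (k - 1) = q k * f k`. After cutting off the triangles under an arc from `i` to `j`,
the equation still holds, with `i` and `j` as neighbours of each other; hence `t i j = 1`. If there
is no such arc, follow the path of longest arcs from `i` to `j` and cut off the triangles under it:
at least two triangles remain at each inner vertex of the path, so `t i` is convex along it and
takes the values `0`, `1`, and then at least `2`.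
-/

namespace InfiniteStrip

section Separates

variable {𝕜 : Type*} [Field 𝕜] [LinearOrder 𝕜]

/-- The pairs `{a, b}` and `{c, d}` separate each other: the four points are distinct and exactly
one of `c`, `d` lies between `a` and `b`. The sign of a polynomial is used because it is insensitive
to the order within each pair and, up to squares, to projective changes of coordinate. -/
def Separates (a b c d : 𝕜) : Prop :=
  (a - c) * (a - d) * (b - c) * (b - d) < 0

variable {a b c d k : 𝕜}

theorem separates_swap_left : Separates a b c d ↔ Separates b a c d := by
  unfold Separates
  ring_nf

theorem separates_swap_right : Separates a b c d ↔ Separates a b d c := by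
  unfold Separates
  ring_nf

theorem separates_comm : Separates a b c d ↔ Separates c d a b := by
  unfold Separates
  ring_nf

variable [IsStrictOrderedRing 𝕜]

theorem separates_iff_of_lt_of_lt (hca : c < a) (had : a < d) :
    Separates a b c d ↔ b < c ∨ d < b := by
  have hneg : (a - c) * (a - d) < 0 := mul_neg_of_pos_of_neg (sub_pos.2 hca) (sub_neg.2 had)
  have hcd : c < d := hca.trans had
  rw [Separates, mul_assoc, ← smul_eq_mul, smul_neg_iff_of_neg_left hneg, mul_pos_iff, sub_pos,
    sub_pos, sub_neg, sub_neg, or_comm]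
  exact or_congr ⟨And.left, fun h => ⟨h, h.trans hcd⟩⟩ ⟨And.right, fun h => ⟨hcd.trans h, h⟩⟩

theorem separates_iff_of_lt (hac : a < c) (hcd : c < d) :
    Separates a b c d ↔ c < b ∧ b < d := by
  have hpos : 0 < (a - c) * (a - d) :=
    mul_pos_of_neg_of_neg (sub_neg.2 hac) (sub_neg.2 (hac.trans hcd))
  rw [Separates, mul_assoc, ← smul_eq_mul, smul_neg_iff_of_pos_left hpos, mul_neg_iff, sub_pos,
    sub_pos, sub_neg, sub_neg]
  exact or_iff_left fun h => lt_asymm hcd (h.2.trans h.1)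

theorem Separates.lt_and_lt_or (h : Separates a b c d) (hab : a < b) :
    a < c ∧ c < b ∨ a < d ∧ d < b := by
  by_contra! hout
  have hside : ∀ e, (a < e → b ≤ e) → 0 ≤ (a - e) * (b - e) := fun e he => by
    rcases le_or_gt e a with hea | hae
    · exact mul_nonneg (sub_nonneg.2 hea) (sub_nonneg.2 (hea.trans hab.le))
    · exact mul_nonneg_of_nonpos_of_nonpos (sub_nonpos.2 hae.le) (sub_nonpos.2 (he hae))
  refine not_lt.2 (mul_nonneg (hside c hout.1) (hside d hout.2)) ?_
  unfold Separates at h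
  linarith

theorem Separates.left_or_right (h : Separates a b c d) (hkc : k ≠ c) (hkd : k ≠ d) :
    Separates k a c d ∨ Separates k b c d := by
  by_contra! hk
  unfold Separates at h hk
  have hsq : 0 < ((k - c) * (k - d)) ^ 2 :=
    sq_pos_of_ne_zero (mul_ne_zero (sub_ne_zero.2 hkc) (sub_ne_zero.2 hkd))
  refine not_lt.2 (mul_nonneg (not_lt.1 hk.1) (not_lt.1 hk.2)) ?_
  linear_combination mul_neg_of_pos_of_neg hsq h

/-- The projective change of coordinate sending `k` to infinity turns separation by a chord through
`k` into separation by a point. -/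
theorem separates_iff_inv (ha : k ≠ a) (hc : k ≠ c) (hd : k ≠ d) :
    Separates k a c d ↔
      ((k - a)⁻¹ - (k - c)⁻¹) * ((k - a)⁻¹ - (k - d)⁻¹) < 0 := by
  have ha' := sub_ne_zero.2 ha
  have hc' := sub_ne_zero.2 hc
  have hd' := sub_ne_zero.2 hd
  have hsq : 0 < (((k - c) * (k - d) * (k - a)) ^ 2)⁻¹ := by positivity
  have hfactor : ((k - a)⁻¹ - (k - c)⁻¹) * ((k - a)⁻¹ - (k - d)⁻¹) =
      (((k - c) * (k - d) * (k - a)) ^ 2)⁻¹ * ((k - c) * (k - d) * (a - c) * (a - d)) := by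
    field_simp
    ring
  rw [hfactor, ← smul_eq_mul, smul_neg_iff_of_pos_left hsq, Separates]

end Separates

section HalfPlane

open Complex ComplexConjugate

theorem continuousOn_log_upperHalfPlane : ContinuousOn log {z | 0 ≤ z.im ∧ z ≠ 0} := by
  rintro z ⟨_, hne⟩
  by_cases hz : z ∈ slitPlane
  · exact (continuousAt_clog hz).continuousWithinAt
  · rw [mem_slitPlane_iff, not_or, not_lt, not_not] at hz
    have hre : z.re < 0 := hz.1.lt_of_ne fun h => hne (Complex.ext h hz.2)
    exact (continuousWithinAt_log_of_re_neg_of_im_zero hre hz.2).mono fun w hw => hw.1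

section Argument

variable {X : Type*} [TopologicalSpace X] [PreconnectedSpace X] {L : X → ℂ}

theorem im_sub_im_eq_of_exp_im_nonneg (hL : Continuous L) (h : ∀ s, 0 ≤ (exp (L s)).im) (s t : X) :
    (L s).im - (L t).im = arg (exp (L s)) - arg (exp (L t)) := by
  have hlog : Continuous fun r => log (exp (L r)) :=
    continuousOn_log_upperHalfPlane.comp_continuous hL.cexp fun r => ⟨h r, exp_ne_zero _⟩
  have hlift : (fun r => log (exp (L r)) + (L t - log (exp (L t)))) = L := by
    refine isCoveringMap_exp.eq_of_comp_eq (by fun_prop) hL ?_ t (by simp)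
    ext r
    simp [exp_add, exp_sub, exp_log (exp_ne_zero _)]
  have him := congrArg im (congrFun hlift s)
  simp only [add_im, sub_im, log_im] at him
  linarith

theorem im_sub_im_eq_of_exp_im_nonpos (hL : Continuous L) (h : ∀ s, (exp (L s)).im ≤ 0) (s t : X) :
    (L s).im - (L t).im = arg (conj (exp (L t))) - arg (conj (exp (L s))) := by
  have hconj := im_sub_im_eq_of_exp_im_nonneg (L := fun r => conj (L r)) (by fun_prop)
    (by simpa [exp_conj] using h) s t
  simp only [exp_conj, conj_im] at hconj
  linarith

end Argument

theorem mul_abs_eq_of_arg_add_arg_eq {p q r s : ℝ}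
    (h : arg (p : ℂ) + arg (q : ℂ) = arg (r : ℂ) + arg (s : ℂ)) :
    p * q * |r * s| = r * s * |p * q| := by
  have hpolar : ∀ u v : ℝ, (u * v : ℂ) = |u * v| * exp ((arg u + arg v : ℝ) * I) := fun u v => by
    conv_lhs => rw [← norm_mul_exp_arg_mul_I (u : ℂ), ← norm_mul_exp_arg_mul_I (v : ℂ)]
    rw [norm_real, norm_real, abs_mul, ofReal_add, add_mul, exp_add, Real.norm_eq_abs,
      Real.norm_eq_abs]
    push_cast
    ring
  have hpq := hpolar p q
  have hrs := hpolar r s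
  rw [h] at hpq
  apply ofReal_injective
  push_cast
  rw [hpq, hrs]
  ring

/-- The square of parameters lifts to a continuous logarithm of `γ s - δ t`; comparing the two ways
around the square gives a relation between the arguments at the corners. -/
theorem exists_eq_of_separates {a b c d : ℝ} (γ : Path (a : ℂ) b) (δ : Path (c : ℂ) d)
    (hγ : ∀ s, 0 ≤ (γ s).im) (hδ : ∀ s, 0 ≤ (δ s).im) (h : Separates a b c d) :
    ∃ s t, γ s = δ t := by
  by_contra! hne
  let F : C(ℝ × ℝ, ℂ) := ⟨fun x => γ.extend x.1 - δ.extend x.2, by fun_prop⟩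
  have hF : ∀ x, F x ∈ ({0}ᶜ : Set ℂ) := fun x => sub_ne_zero.2 (hne _ _)
  replace hγ : ∀ s, 0 ≤ (γ.extend s).im := fun s => hγ _
  replace hδ : ∀ t, 0 ≤ (δ.extend t).im := fun t => hδ _
  obtain ⟨L, ⟨-, hL⟩, -⟩ := isCoveringMapOn_exp.existsUnique_continuousMap_lifts F
    (a₀ := (0, 0)) (e₀ := log (F (0, 0))) (exp_log (hF _)) hF
  have hexp : ∀ s t, exp (L (s, t)) = γ.extend s - δ.extend t := fun s t => congrFun hL (s, t)
  have bottom := im_sub_im_eq_of_exp_im_nonneg (L := fun s => L (s, 0)) (by fun_prop)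
    (fun s => by simpa [hexp] using hγ s) 1 0
  have top := im_sub_im_eq_of_exp_im_nonneg (L := fun s => L (s, 1)) (by fun_prop)
    (fun s => by simpa [hexp] using hγ s) 1 0
  have left := im_sub_im_eq_of_exp_im_nonpos (L := fun t => L (0, t)) (by fun_prop)
    (fun t => by simpa [hexp] using hδ t) 1 0
  have right := im_sub_im_eq_of_exp_im_nonpos (L := fun t => L (1, t)) (by fun_prop)
    (fun t => by simpa [hexp] using hδ t) 1 0
  simp only [hexp, Path.extend_zero, Path.extend_one, ← ofReal_sub, conj_ofReal]
    at bottom top left right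
  have hcorners : arg ((a - c : ℝ) : ℂ) + arg ((b - d : ℝ) : ℂ) =
      arg ((a - d : ℝ) : ℂ) + arg ((b - c : ℝ) : ℂ) := by
    linarith
  have hsign := mul_abs_eq_of_arg_add_arg_eq hcorners
  have hneg : (a - c) * (b - d) * ((a - d) * (b - c)) < 0 := by
    unfold Separates at h
    linarith
  rcases mul_neg_iff.1 hneg with ⟨hpos, hneg⟩ | ⟨hneg, hpos⟩
  · rw [abs_of_neg hneg, abs_of_pos hpos] at hsign
    nlinarith
  · rw [abs_of_neg hneg, abs_of_pos hpos] at hsign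
    nlinarith

/-- The conformal map `z ↦ exp (π z)` from the strip to the closed upper half plane, under which
marked points become real numbers. -/
noncomputable def toHalfPlane (p : Strip) : ℂ :=
  exp (Real.pi * equivRealProdCLM.symm p)

theorem continuous_toHalfPlane : Continuous toHalfPlane := by
  unfold toHalfPlane
  fun_prop

theorem toHalfPlane_im (p : Strip) : (toHalfPlane p).im =
    Real.exp (Real.pi * (p : ℝ × ℝ).1) * Real.sin (Real.pi * (p : ℝ × ℝ).2) := by
  simp [toHalfPlane, exp_im]

theorem toHalfPlane_im_nonneg (p : Strip) : 0 ≤ (toHalfPlane p).im := by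
  rw [toHalfPlane_im]
  exact mul_nonneg (Real.exp_pos _).le (Real.sin_nonneg_of_nonneg_of_le_pi
    (mul_nonneg Real.pi_pos.le p.2.1) (mul_le_of_le_one_right Real.pi_pos.le p.2.2))

theorem snd_mem_Ioo_of_toHalfPlane_im_pos {p : Strip} (h : 0 < (toHalfPlane p).im) :
    (p : ℝ × ℝ).2 ∈ Ioo (0 : ℝ) 1 := by
  rw [toHalfPlane_im] at h
  refine ⟨p.2.1.lt_of_ne fun h0 => ?_, p.2.2.lt_of_ne fun h1 => ?_⟩
  · simp [← h0] at h
  · simp [h1] at h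

theorem toHalfPlane_injective : Function.Injective toHalfPlane := by
  have him : ∀ p : Strip, (Real.pi * equivRealProdCLM.symm p : ℂ).im = Real.pi * (p : ℝ × ℝ).2 := by
    simp
  have hlt : ∀ p : Strip, -Real.pi < (Real.pi * equivRealProdCLM.symm p : ℂ).im := fun p => by
    rw [him]
    linarith [mul_nonneg Real.pi_pos.le p.2.1, Real.pi_pos]
  have hle : ∀ p : Strip, (Real.pi * equivRealProdCLM.symm p : ℂ).im ≤ Real.pi := fun p => by
    rw [him]
    exact mul_le_of_le_one_right Real.pi_pos.le p.2.2
  intro p q h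
  have hmul := exp_inj_of_neg_pi_lt_of_le_pi (hlt p) (hle p) (hlt q) (hle q) h
  exact Subtype.ext (equivRealProdCLM.symm.injective
    (mul_left_cancel₀ (ofReal_ne_zero.2 Real.pi_ne_zero) hmul))

/-- The inverse of `toHalfPlane`, defined away from `0`. -/
noncomputable def ofHalfPlane (w : {w : ℂ // 0 ≤ w.im ∧ w ≠ 0}) : Strip :=
  ⟨((log w).re / Real.pi, (log w).im / Real.pi),
    div_nonneg (log_im w ▸ arg_nonneg_iff.2 w.2.1) Real.pi_pos.le,
    (div_le_one Real.pi_pos).2 (log_im w ▸ arg_le_pi w)⟩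

theorem continuous_ofHalfPlane : Continuous ofHalfPlane := by
  have hlog : Continuous fun w : {w : ℂ // 0 ≤ w.im ∧ w ≠ 0} => log w :=
    continuousOn_log_upperHalfPlane.domRestrict
  exact (((continuous_re.comp hlog).div_const _).prodMk
    ((continuous_im.comp hlog).div_const _)).subtype_mk _

theorem toHalfPlane_ofHalfPlane (w : {w : ℂ // 0 ≤ w.im ∧ w ≠ 0}) :
    toHalfPlane (ofHalfPlane w) = w := by
  have hlog : (Real.pi : ℂ) * equivRealProdCLM.symm (ofHalfPlane w) = log w := by
    apply Complex.ext <;> simp [ofHalfPlane, mul_div_cancel₀ _ Real.pi_ne_zero]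
  rw [toHalfPlane, hlog, exp_log w.2.2]

theorem exists_path_toHalfPlane_eq {p q : Strip} (γ : Path (toHalfPlane p) (toHalfPlane q))
    (him : ∀ s, 0 ≤ (γ s).im) (hne : ∀ s, γ s ≠ 0) :
    ∃ γ' : Path p q, ∀ s, toHalfPlane (γ' s) = γ s :=
  ⟨{  toFun := fun s => ofHalfPlane ⟨γ s, him s, hne s⟩
      continuous_toFun := continuous_ofHalfPlane.comp (by fun_prop)
      source' := toHalfPlane_injective ((toHalfPlane_ofHalfPlane _).trans γ.source)
      target' := toHalfPlane_injective ((toHalfPlane_ofHalfPlane _).trans γ.target) },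
    fun _ => toHalfPlane_ofHalfPlane _⟩

/-- The half circle in the closed upper half plane with endpoints `a` and `b`, parametrized
proportionally to the real part. -/
noncomputable def halfCircle (a b : ℝ) : Path (a : ℂ) b where
  toFun s := (a + (b - a) * s : ℝ) + (|b - a| * √(s * (1 - s)) : ℝ) * I
  continuous_toFun := by fun_prop
  source' := by simp
  target' := by simp

theorem halfCircle_re (a b : ℝ) (s : unitInterval) : (halfCircle a b s).re = a + (b - a) * s := by
  simp [halfCircle]

theorem halfCircle_im (a b : ℝ) (s : unitInterval) :
    (halfCircle a b s).im = |b - a| * √(s * (1 - s)) := by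
  simp [halfCircle]

theorem halfCircle_im_nonneg (a b : ℝ) (s : unitInterval) : 0 ≤ (halfCircle a b s).im := by
  rw [halfCircle_im]
  positivity

theorem halfCircle_injective {a b : ℝ} (hab : a ≠ b) : Function.Injective (halfCircle a b) := by
  intro s t h
  have hre := congrArg re h
  rw [halfCircle_re, halfCircle_re] at hre
  exact Subtype.ext (mul_left_cancel₀ (sub_ne_zero.2 hab.symm) (add_left_cancel hre))

theorem halfCircle_im_pos {a b : ℝ} (hab : a ≠ b) {s : unitInterval} (h0 : s ≠ 0) (h1 : s ≠ 1) :
    0 < (halfCircle a b s).im := by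
  have hs : (0 : ℝ) < s := unitInterval.pos_iff_ne_zero.2 h0
  have hs' : (0 : ℝ) < 1 - s := sub_pos.2 (unitInterval.lt_one_iff_ne_one.2 h1)
  rw [halfCircle_im]
  exact mul_pos (abs_pos.2 (sub_ne_zero.2 hab.symm)) (Real.sqrt_pos.2 (mul_pos hs hs'))

theorem halfCircle_im_eq_zero_iff {a b : ℝ} (hab : a ≠ b) {s : unitInterval} :
    (halfCircle a b s).im = 0 ↔ s = 0 ∨ s = 1 := by
  refine ⟨fun h => ?_, ?_⟩
  · by_contra! hs
    exact (halfCircle_im_pos hab hs.1 hs.2).ne' h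
  · rintro (rfl | rfl) <;> simp

theorem halfCircle_ne_zero {a b : ℝ} (hab : a ≠ b) (ha : a ≠ 0) (hb : b ≠ 0) (s : unitInterval) :
    halfCircle a b s ≠ 0 := by
  intro h
  rcases (halfCircle_im_eq_zero_iff hab).1 (by rw [h, zero_im]) with rfl | rfl
  · exact ha (by simpa using h)
  · exact hb (by simpa using h)

/-- Thales: the altitude of the right triangle over the diameter. -/
theorem halfCircle_im_sq (a b : ℝ) (s : unitInterval) :
    (halfCircle a b s).im ^ 2 = ((halfCircle a b s).re - a) * (b - (halfCircle a b s).re) := by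
  have hs : 0 ≤ (s : ℝ) * (1 - s) := mul_nonneg s.2.1 (sub_nonneg.2 s.2.2)
  rw [halfCircle_im, halfCircle_re, mul_pow, sq_abs, Real.sq_sqrt hs]
  ring

theorem halfCircle_meet {a b c d : ℝ} (hab : a ≠ b) (hcd : c ≠ d) (hne : s(a, b) ≠ s(c, d))
    (h : ¬ Separates a b c d) {s t : unitInterval} (hst : halfCircle a b s = halfCircle c d t) :
    (s = 0 ∨ s = 1) ∧ (t = 0 ∨ t = 1) := by
  suffices him : (halfCircle a b s).im = 0 from
    ⟨(halfCircle_im_eq_zero_iff hab).1 him, (halfCircle_im_eq_zero_iff hcd).1 (hst ▸ him)⟩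
  have hz := halfCircle_im_sq a b s
  have hz' := halfCircle_im_sq c d t
  rw [← hst] at hz'
  generalize halfCircle a b s = z at hz hz'
  by_contra him
  have hac : (a - c) * (a - d) = (a + b - (c + d)) * (a - z.re) := by
    linear_combination hz' - hz
  have hbc : (b - c) * (b - d) = (a + b - (c + d)) * (b - z.re) := by
    linear_combination hz' - hz
  have hprod : (a - c) * (a - d) * (b - c) * (b - d) = -((a + b - (c + d)) * z.im) ^ 2 := by
    rw [mul_assoc, hac, hbc, mul_pow, hz]
    ring
  have hcentre : a + b - (c + d) = 0 := by
    by_contra hcentre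
    rw [Separates, hprod, neg_lt_zero] at h
    exact h (by positivity)
  rw [hcentre, zero_mul] at hac
  rcases mul_eq_zero.1 hac with hac | had
  · exact hne (Sym2.eq_iff.2 (Or.inl ⟨by linarith, by linarith⟩))
  · exact hne (Sym2.eq_iff.2 (Or.inr ⟨by linarith, by linarith⟩))

end HalfPlane

section Compatibility

variable {M₂ : Set ℤ} {P Q R S : MarkedPoint M₂}

/-- The position of a marked point on the boundary of the half plane model of the strip. -/
noncomputable def MarkedPoint.coord : MarkedPoint M₂ → ℝ
  | .lower i => Real.exp (Real.pi * i)
  | .upper u => -Real.exp (Real.pi * (u : ℤ))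

theorem coord_lower_pos (i : ℤ) : 0 < (MarkedPoint.lower i : MarkedPoint M₂).coord :=
  Real.exp_pos _

theorem coord_upper_neg (u : M₂) : (MarkedPoint.upper u).coord < 0 :=
  neg_lt_zero.2 (Real.exp_pos _)

theorem coord_lower_lt {i j : ℤ} :
    (.lower i : MarkedPoint M₂).coord < (.lower j : MarkedPoint M₂).coord ↔ i < j := by
  simp [MarkedPoint.coord, Real.pi_pos]

theorem coord_upper_lt {u v : M₂} :
    (MarkedPoint.upper u).coord < (MarkedPoint.upper v).coord ↔ v < u := by
  simp [MarkedPoint.coord, Real.pi_pos]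

theorem coord_ne_zero : ∀ P : MarkedPoint M₂, P.coord ≠ 0
  | .lower i => (coord_lower_pos i).ne'
  | .upper u => (coord_upper_neg u).ne

theorem coord_injective : Function.Injective (MarkedPoint.coord (M₂ := M₂)) := by
  rintro (i | u) (j | v) h
  · simpa [MarkedPoint.coord, Real.pi_ne_zero] using h
  · exact absurd h ((coord_upper_neg v).trans (coord_lower_pos i)).ne'
  · exact absurd h ((coord_upper_neg u).trans (coord_lower_pos j)).ne
  · simpa [MarkedPoint.coord, Real.pi_ne_zero, SetCoe.ext_iff] using h

theorem toHalfPlane_pos (P : MarkedPoint M₂) : toHalfPlane P.pos = P.coord := by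
  cases P <;> apply Complex.ext <;>
    simp [toHalfPlane, MarkedPoint.pos, MarkedPoint.coord, Complex.exp_re, Complex.exp_im]

theorem exists_isSimpleCurve_halfCircle (hPQ : P ≠ Q) :
    ∃ γ : Path P.pos Q.pos, IsSimpleCurve γ ∧
      ∀ s, toHalfPlane (γ s) = halfCircle P.coord Q.coord s := by
  have hab : P.coord ≠ Q.coord := coord_injective.ne hPQ
  obtain ⟨γ, hγ⟩ := exists_path_toHalfPlane_eq
    ((halfCircle P.coord Q.coord).cast (toHalfPlane_pos P) (toHalfPlane_pos Q))
    (halfCircle_im_nonneg _ _) (halfCircle_ne_zero hab (coord_ne_zero P) (coord_ne_zero Q))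
  refine ⟨γ, ⟨fun s t hst => halfCircle_injective hab ?_, fun s h0 h1 => ?_⟩, hγ⟩
  · exact (hγ s).symm.trans ((congrArg toHalfPlane hst).trans (hγ t))
  · exact snd_mem_Ioo_of_toHalfPlane_im_pos ((halfCircle_im_pos hab h0 h1).trans_eq
      (congrArg Complex.im (hγ s).symm))

theorem Compatible.symm {e f : Sym2 (MarkedPoint M₂)} (h : Compatible e f) : Compatible f e := by
  obtain ⟨P, Q, R, S, γ, δ, he, hf, hγ, hδ, hmeet⟩ := h
  exact ⟨R, S, P, Q, δ, γ, hf, he, hδ, hγ, fun s t hst => (hmeet t s hst.symm).symm⟩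

theorem compatible_of_not_separates (hPQ : P ≠ Q) (hRS : R ≠ S) (hne : s(P, Q) ≠ s(R, S))
    (h : ¬ Separates P.coord Q.coord R.coord S.coord) : Compatible s(P, Q) s(R, S) := by
  obtain ⟨γ, hγ, hγ'⟩ := exists_isSimpleCurve_halfCircle hPQ
  obtain ⟨δ, hδ, hδ'⟩ := exists_isSimpleCurve_halfCircle hRS
  refine ⟨P, Q, R, S, γ, δ, rfl, rfl, hγ, hδ, fun s t hst => halfCircle_meet
    (coord_injective.ne hPQ) (coord_injective.ne hRS)
    ((Sym2.map.injective coord_injective).ne hne) h ?_⟩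
  rw [← hγ', ← hδ', hst]

theorem not_compatible_of_separates (h : Separates P.coord Q.coord R.coord S.coord) :
    ¬ Compatible s(P, Q) s(R, S) := by
  rintro ⟨P', Q', R', S', γ, δ, he, hf, -, -, hmeet⟩
  have h' : Separates P'.coord Q'.coord R'.coord S'.coord := by
    rcases Sym2.eq_iff.1 he with ⟨rfl, rfl⟩ | ⟨rfl, rfl⟩ <;>
      rcases Sym2.eq_iff.1 hf with ⟨rfl, rfl⟩ | ⟨rfl, rfl⟩ <;>
      first
        | exact h
        | exact separates_swap_left.1 h
        | exact separates_swap_right.1 h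
        | exact separates_swap_left.1 (separates_swap_right.1 h)
  obtain ⟨s, t, hst⟩ := exists_eq_of_separates
    ((γ.map continuous_toHalfPlane).cast (toHalfPlane_pos P').symm (toHalfPlane_pos Q').symm)
    ((δ.map continuous_toHalfPlane).cast (toHalfPlane_pos R').symm (toHalfPlane_pos S').symm)
    (fun _ => toHalfPlane_im_nonneg _) (fun _ => toHalfPlane_im_nonneg _) h'
  change toHalfPlane (γ s) = toHalfPlane (δ t) at hst
  obtain ⟨rfl | rfl, rfl | rfl⟩ := hmeet s t (toHalfPlane_injective hst) <;>
    simp only [Path.source, Path.target, toHalfPlane_pos, Complex.ofReal_inj] at hst <;>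
    simp [Separates, hst] at h'

theorem IsBoundarySegment.symm (h : IsBoundarySegment P Q) : IsBoundarySegment Q P := by
  cases P <;> cases Q <;> first | exact h | exact Or.symm h

theorem IsBoundarySegment.coord_notMem_Ioo (h : IsBoundarySegment P Q) (R : MarkedPoint M₂) :
    R.coord ∉ Ioo P.coord Q.coord := by
  rintro ⟨hPR, hRQ⟩
  rcases P with i | u <;> rcases Q with j | v
  · rcases R with k | w
    · rw [coord_lower_lt] at hPR hRQ
      exact h.elim (fun h => h.2 hPR hRQ) fun h => (hPR.trans hRQ).not_gt h.1
    · exact hPR.not_gt ((coord_upper_neg w).trans (coord_lower_pos i))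
  · exact h
  · exact h
  · rcases R with k | w
    · exact hRQ.not_gt ((coord_upper_neg v).trans (coord_lower_pos k))
    · rw [coord_upper_lt] at hPR hRQ
      exact h.elim (fun h => (hRQ.trans hPR).not_gt h.1) fun h => h.2 hRQ hPR

theorem IsBoundarySegment.not_separates (h : IsBoundarySegment P Q) (R S : MarkedPoint M₂) :
    ¬ Separates P.coord Q.coord R.coord S.coord := by
  intro hsep
  rcases lt_trichotomy P.coord Q.coord with hlt | heq | hlt
  · exact (hsep.lt_and_lt_or hlt).elim (h.coord_notMem_Ioo R) (h.coord_notMem_Ioo S)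
  · obtain rfl := coord_injective heq
    cases P <;> simp [IsBoundarySegment] at h
  · exact ((separates_swap_left.1 hsep).lt_and_lt_or hlt).elim (h.symm.coord_notMem_Ioo R)
      (h.symm.coord_notMem_Ioo S)

end Compatibility

section Link

variable {V : Type*} {G : SimpleGraph V} {k a b : V}

/-- The triangles of a graph incident with the vertex `k`. -/
def trianglesThrough (G : SimpleGraph V) (k : V) : Set (Finset V) :=
  {Δ | G.IsNClique 3 Δ ∧ k ∈ Δ}

theorem bijOn_trianglesThrough [DecidableEq V] [LinearOrder (G.neighborSet k)] :
    BijOn (fun p : G.neighborSet k × G.neighborSet k => ({k, ↑p.1, ↑p.2} : Finset V))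
      {p | p.1 < p.2 ∧ G.Adj p.1 p.2} (trianglesThrough G k) := by
  have herase : ∀ a b : G.neighborSet k, ({k, ↑a, ↑b} : Finset V).erase k = {↑a, ↑b} := fun a b =>
    Finset.erase_insert (by simp [a.2.ne, b.2.ne])
  refine ⟨?_, ?_, ?_⟩
  · rintro ⟨a, b⟩ ⟨-, hab⟩
    exact ⟨SimpleGraph.is3Clique_triple_iff.2 ⟨a.2, b.2, hab⟩, Finset.mem_insert_self _ _⟩
  · rintro ⟨a, b⟩ ⟨hab, -⟩ ⟨a', b'⟩ ⟨hab', -⟩ h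
    have hpair : ({↑a, ↑b} : Finset V) = {↑a', ↑b'} :=
      (herase a b).symm.trans ((congrArg (Finset.erase · k) h).trans (herase a' b'))
    rw [← Finset.coe_inj, Finset.coe_pair, Finset.coe_pair, Set.pair_eq_pair_iff] at hpair
    rcases hpair with ⟨ha, hb⟩ | ⟨ha, hb⟩
    · exact Prod.ext (Subtype.ext ha) (Subtype.ext hb)
    · rw [Subtype.ext ha, Subtype.ext hb] at hab
      exact absurd hab hab'.not_gt
  · rintro Δ ⟨hΔ, hk⟩
    obtain ⟨a, b, hab, hedge⟩ := Finset.card_eq_two.1 (hΔ.erase_of_mem hk).card_eq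
    have htriple : Δ = {k, a, b} := by rw [← Finset.insert_erase hk, hedge]
    obtain ⟨ha, hb, hadj⟩ := SimpleGraph.is3Clique_triple_iff.1 (htriple ▸ hΔ)
    lift a to G.neighborSet k using ha
    lift b to G.neighborSet k using hb
    rcases lt_or_gt_of_ne (fun h => hab (congrArg Subtype.val h)) with hlt | hlt
    · exact ⟨(a, b), ⟨hlt, hadj⟩, htriple.symm⟩
    · exact ⟨(b, a), ⟨hlt, hadj.symm⟩, by rw [htriple, Finset.pair_comm]⟩

theorem finite_trianglesThrough (hfin : (G.neighborSet k).Finite) :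
    (trianglesThrough G k).Finite := by
  classical
  let := IsWellOrder.linearOrder (WellOrderingRel (α := G.neighborSet k))
  have := hfin.to_subtype
  rw [← bijOn_trianglesThrough.image_eq]
  exact (Set.toFinite _).image _

theorem ncard_setOf_covBy_add_one (α : Type*) [LinearOrder α] [Finite α] [Nonempty α] :
    {p : α × α | p.1 ⋖ p.2}.ncard + 1 = Nat.card α := by
  obtain ⟨m, hm⟩ := Finite.exists_max (id : α → α)
  have himage : Prod.fst '' {p : α × α | p.1 ⋖ p.2} = univ \ {m} := by
    ext a
    constructor
    · rintro ⟨⟨a, b⟩, hab, rfl⟩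
      exact ⟨mem_univ a, fun h => (hm b).not_gt (h ▸ hab.1)⟩
    · rintro ⟨-, ham⟩
      obtain ⟨b, hab⟩ := exists_covBy_of_wellFoundedLT (not_isMax_of_lt ((hm a).lt_of_ne ham))
      exact ⟨(a, b), hab, rfl⟩
  have hinj : InjOn Prod.fst {p : α × α | p.1 ⋖ p.2} := fun p hp q hq h =>
    Prod.ext h (hp.unique_right (h ▸ hq))
  rw [← hinj.ncard_image, himage, ncard_sdiff_singleton_add_one (mem_univ m), ncard_univ]

end Link

section MaximalNoncrossing

variable {V 𝕜 : Type*} [Field 𝕜] [LinearOrder 𝕜] {x : V → 𝕜} {G : SimpleGraph V} {k a b : V}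

/-- The combinatorics of a triangulation of a polygon, possibly with infinitely many vertices: `x`
places the vertices on a line (an affine chart of a circle), and the edges, boundary edges included,
are a maximal set of chords no two of which separate each other. -/
structure IsMaximalNoncrossing (x : V → 𝕜) (G : SimpleGraph V) : Prop where
  injective : Function.Injective x
  not_separates : ∀ {a b c d}, G.Adj a b → G.Adj c d → ¬ Separates (x a) (x b) (x c) (x d)
  exists_separates : ∀ {a b}, a ≠ b → ¬ G.Adj a b →
    ∃ c d, G.Adj c d ∧ Separates (x a) (x b) (x c) (x d)

/-- The vertices in the order in which they are seen from `k`: a projective coordinate in which `k`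
is at infinity. -/
def viewFrom (x : V → 𝕜) (k a : V) : 𝕜 := (x k - x a)⁻¹

namespace IsMaximalNoncrossing

theorem viewFrom_injective (hG : IsMaximalNoncrossing x G) (k : V) :
    Function.Injective (viewFrom x k) :=
  inv_injective.comp ((sub_right_injective).comp hG.injective)

variable [IsStrictOrderedRing 𝕜]

theorem adj_iff (hG : IsMaximalNoncrossing x G) (ha : G.Adj k a) (hb : G.Adj k b) (hab : a ≠ b) :
    G.Adj a b ↔ ∀ c, G.Adj k c → ¬ Separates (x k) (x c) (x a) (x b) := by
  refine ⟨fun h c hc => hG.not_separates hc h, fun h => ?_⟩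
  by_contra hnadj
  obtain ⟨c, d, hcd, hsep⟩ := hG.exists_separates hab hnadj
  have hkc : k ≠ c := by
    rintro rfl
    exact h d hcd (separates_comm.1 hsep)
  have hkd : k ≠ d := by
    rintro rfl
    exact h c hcd.symm (separates_comm.1 (separates_swap_right.1 hsep))
  exact (hsep.left_or_right (hG.injective.ne hkc) (hG.injective.ne hkd)).elim
    (hG.not_separates ha hcd) (hG.not_separates hb hcd)

theorem separates_iff_viewFrom (hG : IsMaximalNoncrossing x G) {c : V} (ha : G.Adj k a)
    (hb : G.Adj k b) (hc : G.Adj k c) (hab : viewFrom x k a < viewFrom x k b) :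
    Separates (x k) (x c) (x a) (x b) ↔
      viewFrom x k a < viewFrom x k c ∧ viewFrom x k c < viewFrom x k b := by
  rw [separates_iff_inv (hG.injective.ne hc.ne) (hG.injective.ne ha.ne) (hG.injective.ne hb.ne),
    mul_neg_iff, sub_pos, sub_neg, sub_neg, sub_pos]
  exact or_iff_left fun h => lt_asymm hab (h.2.trans h.1)

theorem ncard_trianglesThrough_add_one (hG : IsMaximalNoncrossing x G)
    (hfin : (G.neighborSet k).Finite) (hne : (G.neighborSet k).Nonempty) :
    (trianglesThrough G k).ncard + 1 = (G.neighborSet k).ncard := by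
  classical
  let : LinearOrder (G.neighborSet k) := LinearOrder.lift' (fun a => viewFrom x k a)
    ((hG.viewFrom_injective k).comp Subtype.val_injective)
  have := hfin.to_subtype
  have := hne.to_subtype
  have hcov : {p : G.neighborSet k × G.neighborSet k | p.1 < p.2 ∧ G.Adj p.1 p.2} =
      {p | p.1 ⋖ p.2} := by
    ext ⟨a, b⟩
    refine and_congr_right fun hab => ?_
    rw [hG.adj_iff a.2 b.2 (Subtype.coe_ne_coe.2 hab.ne)]
    refine ⟨fun h c hac hcb => h c c.2 ?_, fun h c hc hsep => ?_⟩
    · exact (hG.separates_iff_viewFrom a.2 b.2 c.2 hab).2 ⟨hac, hcb⟩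
    · obtain ⟨hac, hcb⟩ := (hG.separates_iff_viewFrom a.2 b.2 hc hab).1 hsep
      exact h (c := ⟨c, hc⟩) hac hcb
  rw [← bijOn_trianglesThrough.image_eq, bijOn_trianglesThrough.injOn.ncard_image, hcov,
    ncard_setOf_covBy_add_one, Nat.card_coe_set_eq]

end IsMaximalNoncrossing

end MaximalNoncrossing

section DegreeIn

variable {α : Type*} [LinearOrder α] [LocallyFiniteOrder α]

open Classical in
/-- The number of neighbours of `x` strictly between `i` and `j`. -/
noncomputable def degreeIn (H : SimpleGraph α) (x i j : α) : ℕ :=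
  (Finset.filter (H.Adj x) (Finset.Ioo i j)).card

variable {H : SimpleGraph α} {x i j k : α}

theorem degreeIn_eq_zero (h : ∀ k, i < k → k < j → ¬ H.Adj x k) : degreeIn H x i j = 0 := by
  classical
  rw [degreeIn, Finset.card_eq_zero, Finset.filter_eq_empty_iff]
  exact fun k hk => h k (Finset.mem_Ioo.1 hk).1 (Finset.mem_Ioo.1 hk).2

open Classical in
theorem degreeIn_split (hik : i < k) (hkj : k < j) :
    degreeIn H x i j = degreeIn H x i k + degreeIn H x k j + if H.Adj x k then 1 else 0 := by
  have hunion : Finset.Ioo i j = Finset.Ioo i k ∪ insert k (Finset.Ioo k j) := by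
    rw [Finset.Ioo_insert_left hkj, ← Finset.coe_inj]
    push_cast
    exact (Set.Ioo_union_Ico_eq_Ioo hik hkj.le).symm
  have hdisj : Disjoint (Finset.Ioo i k) (insert k (Finset.Ioo k j)) := by
    rw [Finset.Ioo_insert_left hkj, Finset.disjoint_left]
    exact fun m hm hm' => (Finset.mem_Ioo.1 hm).2.not_ge (Finset.mem_Ico.1 hm').1
  rw [degreeIn, hunion, Finset.filter_union, Finset.card_union_of_disjoint
    (Finset.disjoint_filter_filter hdisj), Finset.filter_insert]
  split_ifs
  · rw [Finset.card_insert_of_notMem (by simp), ← add_assoc, degreeIn, degreeIn]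
  · rfl

theorem degreeIn_split_of_adj (hik : i < k) (hkj : k < j) (h : H.Adj x k) :
    degreeIn H x i j = degreeIn H x i k + degreeIn H x k j + 1 := by
  rw [degreeIn_split hik hkj, if_pos h]

theorem ncard_neighborSet_inter_Icc (hix : i < x) (hxj : x < j) (hi : H.Adj x i) (hj : H.Adj x j) :
    (H.neighborSet x ∩ Icc i j).ncard = degreeIn H x i x + degreeIn H x x j + 2 := by
  classical
  have hIcc : Icc i j = insert i (insert j (Ioo i j)) := by
    rw [Ioo_insert_right (hix.trans hxj), Ioc_insert_left (hix.trans hxj).le]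
  have hset : H.neighborSet x ∩ Icc i j =
      (insert i (insert j ((Finset.Ioo i j).filter (H.Adj x))) : Finset α) := by
    push_cast
    rw [hIcc, inter_insert_of_mem ((H.mem_neighborSet x i).2 hi),
      inter_insert_of_mem ((H.mem_neighborSet x j).2 hj), inter_comm, ← Finset.coe_Ioo]
    rfl
  have hsplit := degreeIn_split (H := H) (x := x) hix hxj
  rw [if_neg H.irrefl, add_zero] at hsplit
  rw [hset, ncard_coe_finset, Finset.card_insert_of_notMem (by simp [(hix.trans hxj).ne]),
    Finset.card_insert_of_notMem (by simp), ← hsplit, degreeIn]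

end DegreeIn

section BoundaryChain

variable {V 𝕜 : Type*} [LinearOrder 𝕜] {x : V → 𝕜} {v : ℤ → V} {i j : ℤ} {w : V}

/-- The vertices `v i`, in increasing order, are consecutive on the line: no other vertex lies
between two of them. -/
structure IsBoundaryChain (x : V → 𝕜) (v : ℤ → V) : Prop where
  strictMono : StrictMono (x ∘ v)
  mem_range : ∀ {i j w}, x (v i) < x w → x w < x (v j) → w ∈ range v

namespace IsBoundaryChain

theorem injective (hv : IsBoundaryChain x v) : Function.Injective v :=
  hv.strictMono.injective.of_comp

theorem lt_iff (hv : IsBoundaryChain x v) : x (v i) < x (v j) ↔ i < j :=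
  hv.strictMono.lt_iff_lt

theorem exists_eq_of_lt_of_lt (hv : IsBoundaryChain x v) (hi : x (v i) < x w)
    (hj : x w < x (v j)) : ∃ k, i < k ∧ k < j ∧ v k = w := by
  obtain ⟨k, rfl⟩ := hv.mem_range hi hj
  exact ⟨k, hv.lt_iff.1 hi, hv.lt_iff.1 hj, rfl⟩

theorem mem_image_Icc (hv : IsBoundaryChain x v) (hx : Function.Injective x) (hij : i ≤ j) :
    w ∈ v '' Icc i j ↔ x (v i) ≤ x w ∧ x w ≤ x (v j) := by
  constructor
  · rintro ⟨k, hk, rfl⟩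
    exact ⟨hv.strictMono.monotone hk.1, hv.strictMono.monotone hk.2⟩
  · rintro ⟨hi, hj⟩
    rcases hi.eq_or_lt with hi | hi
    · exact ⟨i, left_mem_Icc.2 hij, hx hi⟩
    rcases hj.eq_or_lt with hj | hj
    · exact ⟨j, right_mem_Icc.2 hij, hx hj.symm⟩
    obtain ⟨k, hik, hkj, rfl⟩ := hv.exists_eq_of_lt_of_lt hi hj
    exact ⟨k, ⟨hik.le, hkj.le⟩, rfl⟩

end IsBoundaryChain

end BoundaryChain

/-- The properties of the arcs of a triangulation between the points of a boundary line indexed by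
`ℤ`, boundary segments included, and of the numbers `q i` of triangles incident with these
points. -/
structure IsBoundaryGraph (H : SimpleGraph ℤ) (q : ℤ → ℤ) : Prop where
  adj_succ : ∀ i, H.Adj i (i + 1)
  not_adj_of_adj : ∀ {a b c d}, a < b → b < c → c < d → H.Adj a c → ¬ H.Adj b d
  adj_of_consecutive : ∀ {i k j}, i < k → k < j → H.Adj i k → H.Adj i j →
    (∀ m, k < m → m < j → ¬ H.Adj i m) → H.Adj k j
  eq_of_adj : ∀ {i k j}, i < k → k < j → H.Adj i k → H.Adj k j → H.Adj i j →
    q k = degreeIn H k i k + degreeIn H k k j + 1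
  le_of_not_adj : ∀ {i k j}, i < k → k < j → H.Adj i k → H.Adj k j → ¬ H.Adj i j →
    degreeIn H k i k + degreeIn H k k j + 2 ≤ q k

section ChainNoncrossing

variable {V 𝕜 : Type*} [Field 𝕜] [LinearOrder 𝕜] [IsStrictOrderedRing 𝕜] {x : V → 𝕜}
  {G : SimpleGraph V} {v : ℤ → V} {i j k : ℤ}

namespace IsMaximalNoncrossing

theorem adj_succ (hG : IsMaximalNoncrossing x G) (hv : IsBoundaryChain x v) (i : ℤ) :
    G.Adj (v i) (v (i + 1)) := by
  by_contra h
  have hlt : x (v i) < x (v (i + 1)) := hv.lt_iff.2 (lt_add_one i)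
  have hgap : ∀ w, ¬ (x (v i) < x w ∧ x w < x (v (i + 1))) := fun w hw => by
    obtain ⟨k, hik, hki, -⟩ := hv.exists_eq_of_lt_of_lt hw.1 hw.2
    omega
  obtain ⟨c, d, -, hsep⟩ := hG.exists_separates (hG.injective.ne_iff.1 hlt.ne) h
  exact (hsep.lt_and_lt_or hlt).elim (hgap c) (hgap d)

theorem not_adj_of_adj (hG : IsMaximalNoncrossing x G) (hv : IsBoundaryChain x v) {a b c d : ℤ}
    (hab : a < b) (hbc : b < c) (hcd : c < d) (h : G.Adj (v a) (v c)) : ¬ G.Adj (v b) (v d) :=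
  fun h' => hG.not_separates h h' ((separates_iff_of_lt (hv.lt_iff.2 hab)
    (hv.lt_iff.2 (hbc.trans hcd))).2 ⟨hv.lt_iff.2 hbc, hv.lt_iff.2 hcd⟩)

theorem adj_of_consecutive (hG : IsMaximalNoncrossing x G) (hv : IsBoundaryChain x v)
    (hik : i < k) (hkj : k < j) (hk : G.Adj (v i) (v k)) (hj : G.Adj (v i) (v j))
    (h : ∀ m, k < m → m < j → ¬ G.Adj (v i) (v m)) : G.Adj (v k) (v j) := by
  rw [hG.adj_iff hk hj (hv.injective.ne hkj.ne)]
  intro c hc hsep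
  obtain ⟨hkc, hcj⟩ := (separates_iff_of_lt (hv.lt_iff.2 hik) (hv.lt_iff.2 hkj)).1 hsep
  obtain ⟨m, hkm, hmj, rfl⟩ := hv.exists_eq_of_lt_of_lt hkc hcj
  exact h m hkm hmj hc

theorem adj_iff_neighborSet_subset (hG : IsMaximalNoncrossing x G) (hv : IsBoundaryChain x v)
    (hik : i < k) (hkj : k < j) (hi : G.Adj (v k) (v i)) (hj : G.Adj (v k) (v j)) :
    G.Adj (v i) (v j) ↔ G.neighborSet (v k) ⊆ v '' Icc i j := by
  rw [hG.adj_iff hi hj (hv.injective.ne (hik.trans hkj).ne)]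
  refine forall₂_congr fun c _ => ?_
  rw [hv.mem_image_Icc hG.injective (hik.trans hkj).le,
    separates_iff_of_lt_of_lt (hv.lt_iff.2 hik) (hv.lt_iff.2 hkj), not_or, not_lt, not_lt]

theorem isBoundaryGraph (hG : IsMaximalNoncrossing x G) (hv : IsBoundaryChain x v)
    (hfin : ∀ i, (G.neighborSet (v i)).Finite) :
    IsBoundaryGraph (G.comap v) fun i => (trianglesThrough G (v i)).ncard := by
  have hcount : ∀ k, (trianglesThrough G (v k)).ncard + 1 = (G.neighborSet (v k)).ncard := fun k =>
    hG.ncard_trianglesThrough_add_one (hfin k) ⟨_, hG.adj_succ hv k⟩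
  have hinter : ∀ {i k j}, i < k → k < j → G.Adj (v i) (v k) → G.Adj (v k) (v j) →
      (G.neighborSet (v k) ∩ v '' Icc i j).ncard =
        degreeIn (G.comap v) k i k + degreeIn (G.comap v) k k j + 2 := by
    intro i k j hik hkj hi hj
    rw [← ncard_neighborSet_inter_Icc hik hkj (H := G.comap v) hi.symm hj,
      ← ncard_image_of_injective _ hv.injective, inter_comm, ← image_inter_preimage, inter_comm]
    rfl
  refine ⟨hG.adj_succ hv, hG.not_adj_of_adj hv, hG.adj_of_consecutive hv, ?_, ?_⟩
  · intro i k j hik hkj hi hj hij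
    have hsub := (hG.adj_iff_neighborSet_subset hv hik hkj hi.symm hj).1 hij
    have hcard := hinter hik hkj hi hj
    rw [inter_eq_left.2 hsub, ← hcount] at hcard
    exact_mod_cast Nat.succ_injective hcard
  · intro i k j hik hkj hi hj hij
    have hsub := (hG.adj_iff_neighborSet_subset hv hik hkj hi.symm hj).not.1 hij
    have hlt := ncard_lt_ncard (inter_ssubset_left_iff.2 hsub) (hfin k)
    rw [hinter hik hkj hi hj, ← hcount, Nat.lt_succ_iff] at hlt
    exact_mod_cast hlt

end IsMaximalNoncrossing

end ChainNoncrossing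

section HillEquation

variable {R : Type*} [CommRing R] {q : ℤ → R} {f g : ℤ → R}

/-- The discrete Hill equation with coefficients `q`. -/
def IsHillSolution (q f : ℤ → R) : Prop :=
  ∀ k, f (k + 1) + f (k - 1) = q k * f k

namespace IsHillSolution

theorem const_mul_sub_const_mul (hf : IsHillSolution q f) (hg : IsHillSolution q g) (a b : R) :
    IsHillSolution q fun k => a * f k - b * g k := fun k => by
  linear_combination a * hf k - b * hg k

theorem wronskian_eq (hf : IsHillSolution q f) (hg : IsHillSolution q g) (k : ℤ) :
    f k * g (k + 1) - g k * f (k + 1) = f 0 * g 1 - g 0 * f 1 := by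
  have hsucc : ∀ k, f k * g (k + 1) - g k * f (k + 1) = f (k - 1) * g k - g (k - 1) * f k :=
    fun k => by linear_combination f k * hg k - g k * hf k
  induction k with
  | zero => rw [zero_add]
  | succ n ih => rw [hsucc, add_sub_cancel_right, ih]
  | pred n ih => rwa [hsucc, ← sub_add_cancel (-(n : ℤ)) 1, add_sub_cancel_right] at ih

end IsHillSolution

theorem exists_forall_add_one_eq {α : Type*} (e : ℤ → Equiv.Perm α) (a : α) :
    ∃ s : ℤ → α, s 0 = a ∧ ∀ k, s (k + 1) = e k (s k) := by
  let s : ℤ → α := fun k =>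
    Int.inductionOn' k 0 a (fun k _ b => e k b) fun k _ b => (e (k - 1)).symm b
  refine ⟨s, Int.inductionOn'_self, fun k => ?_⟩
  rcases le_or_gt 0 k with hk | hk
  · exact Int.inductionOn'_add_one hk
  · have hpred : s (k + 1 - 1) = (e (k + 1 - 1)).symm (s (k + 1)) :=
      Int.inductionOn'_sub_one (Int.add_one_le_of_lt hk)
    rw [add_sub_cancel_right] at hpred
    rw [hpred, Equiv.apply_symm_apply]

theorem exists_isHillSolution (q : ℤ → R) (a b : R) :
    ∃ f, IsHillSolution q f ∧ f 0 = a ∧ f 1 = b := by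
  let step (k : ℤ) : Equiv.Perm (R × R) :=
    { toFun := fun p => (p.2, q (k + 1) * p.2 - p.1)
      invFun := fun p => (q (k + 1) * p.1 - p.2, p.1)
      left_inv := fun p => by simp
      right_inv := fun p => by simp }
  obtain ⟨s, hzero, hsucc⟩ := exists_forall_add_one_eq step (a, b)
  have hfst : ∀ k, (s (k + 1)).1 = (s k).2 := fun k => congrArg Prod.fst (hsucc k)
  have hsnd : ∀ k, (s (k + 1)).2 = q (k + 1) * (s k).2 - (s k).1 := fun k =>
    congrArg Prod.snd (hsucc k)
  refine ⟨fun k => (s k).1, fun k => ?_, congrArg Prod.fst hzero,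
    (hfst 0).trans (congrArg Prod.snd hzero)⟩
  have hk := hsnd (k - 1)
  rw [sub_add_cancel, ← hfst, ← hfst, sub_add_cancel] at hk
  exact eq_sub_iff_add_eq.1 hk

theorem exists_unimodular_isHillSolution (q : ℤ → R) :
    ∃ t : ℤ → ℤ → R, (∀ i, IsHillSolution q (t i)) ∧ (∀ i, t i i = 0) ∧ (∀ i, t i (i + 1) = 1) ∧
      (∀ i j, t i j = -t j i) ∧
        ∀ i j, t i j * t (i + 1) (j + 1) - t i (j + 1) * t (i + 1) j = 1 := by
  obtain ⟨f, hf, hf0, hf1⟩ := exists_isHillSolution q 1 0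
  obtain ⟨g, hg, hg0, hg1⟩ := exists_isHillSolution q 0 1
  have hW : ∀ k, f k * g (k + 1) - g k * f (k + 1) = 1 := fun k => by
    rw [hf.wronskian_eq hg, hf0, hg0, hf1, hg1, mul_one, zero_mul, sub_zero]
  refine ⟨fun i j => f i * g j - g i * f j, fun i => hg.const_mul_sub_const_mul hf _ _,
    fun i => by ring, hW, fun i j => by ring, fun i j => ?_⟩
  -- Multiplicativity of the determinant of `2 × 2` matrices.
  linear_combination (f j * g (j + 1) - g j * f (j + 1)) * hW i + hW j

end HillEquation

namespace IsBoundaryGraph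

variable {H : SimpleGraph ℤ} {q f : ℤ → ℤ} {i j p x y : ℤ}

theorem exists_greatest_adj (hH : IsBoundaryGraph H q) (hxj : x < j) :
    ∃ y, x < y ∧ y ≤ j ∧ H.Adj x y ∧ ∀ w, y < w → w ≤ j → ¬ H.Adj x w := by
  obtain ⟨y, ⟨⟨hxy, hyj⟩, hadj⟩, hmax⟩ := ((finite_Ioc x j).inter_of_left (H.neighborSet x))
    |>.exists_maximal ⟨x + 1, ⟨lt_add_one x, hxj⟩, hH.adj_succ x⟩
  exact ⟨y, hxy, hyj, hadj, fun w hyw hwj hxw =>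
    hyw.not_ge (hmax ⟨⟨hxy.trans hyw, hwj⟩, hxw⟩ hyw.le)⟩

theorem exists_triangle_of_adj (hH : IsBoundaryGraph H q) (hij : i + 1 < j) (h : H.Adj i j) :
    ∃ k, i < k ∧ k < j ∧ H.Adj i k ∧ H.Adj k j ∧
      degreeIn H i i j = degreeIn H i i k + 1 ∧ degreeIn H j i j = degreeIn H j k j + 1 := by
  obtain ⟨k, hik, hkj, hk, hmax⟩ := hH.exists_greatest_adj (x := i) (j := j - 1) (by omega)
  have hgap : ∀ m, k < m → m < j → ¬ H.Adj i m := fun m hkm hmj =>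
    hmax m hkm (Int.le_sub_one_of_lt hmj)
  replace hkj : k < j := Int.lt_of_le_sub_one hkj
  have hadj := hH.adj_of_consecutive hik hkj hk h hgap
  refine ⟨k, hik, hkj, hk, hadj, ?_, ?_⟩
  · rw [degreeIn_split_of_adj hik hkj hk, degreeIn_eq_zero hgap, add_zero]
  · rw [degreeIn_split_of_adj hik hkj hadj.symm, degreeIn_eq_zero, zero_add]
    exact fun m him hmk hm => hH.not_adj_of_adj him hmk hkj hk hm.symm

/-- Along an arc, the Hill equation is solved with the triangles under the arc removed. -/
theorem hill_of_adj (hH : IsBoundaryGraph H q) (hf : IsHillSolution q f) (hij : i < j)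
    (h : H.Adj i j) : f (i + 1) = f j + degreeIn H i i j * f i ∧
      f (j - 1) = f i + degreeIn H j i j * f j := by
  induction hn : (j - i).toNat using Nat.strong_induction_on generalizing i j with
  | _ n ih =>
  rcases (Int.add_one_le_of_lt hij).eq_or_lt with rfl | hlt
  · have hzero : ∀ x, degreeIn H x i (i + 1) = 0 := fun x =>
      degreeIn_eq_zero fun k hik hki => absurd hki (Int.add_one_le_of_lt hik).not_gt
    simp [hzero]
  · obtain ⟨k, hik, hkj, hk, hkadj, hdegi, hdegj⟩ := hH.exists_triangle_of_adj hlt h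
    obtain ⟨hi, hleft⟩ := ih _ (by omega) hik hk rfl
    obtain ⟨hright, hj⟩ := ih _ (by omega) hkj hkadj rfl
    have hmid := hf k
    rw [hH.eq_of_adj hik hkj hk hkadj h] at hmid
    rw [hdegi, hdegj]
    push_cast
    constructor
    · linear_combination hi - hmid + hright + hleft
    · linear_combination hj - hmid + hright + hleft

theorem eq_one_of_adj (hH : IsBoundaryGraph H q) (hf : IsHillSolution q f) (hi : f i = 0)
    (hsucc : f (i + 1) = 1) (hij : i < j) (h : H.Adj i j) : f j = 1 := by
  simpa [hi, hsucc] using (hH.hill_of_adj hf hij h).1.symm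

theorem two_mul_le (hH : IsBoundaryGraph H q) (hf : IsHillSolution q f) (hpx : p < x)
    (hxy : x < y) (hp : H.Adj p x) (hy : H.Adj x y) (hpy : ¬ H.Adj p y) (hx : 0 ≤ f x) :
    2 * f x ≤ f p + f y := by
  have hleft := (hH.hill_of_adj hf hpx hp).2
  have hright := (hH.hill_of_adj hf hxy hy).1
  have hle := mul_le_mul_of_nonneg_right (hH.le_of_not_adj hpx hxy hp hy hpy) hx
  rw [← hf x, hleft, hright] at hle
  linarith

/-- By convexity, a solution keeps increasing along the path of longest arcs from `i` to `j`. -/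
theorem two_le_of_path (hH : IsBoundaryGraph H q) (hf : IsHillSolution q f) (hip : i ≤ p)
    (hpx : p < x) (hxj : x < j) (h : H.Adj p x) (hp : 0 ≤ f p) (hpx' : f p < f x)
    (hcover : ∀ z w, i ≤ z → z < x → x < w → w ≤ j → ¬ H.Adj z w) : 2 ≤ f j := by
  induction hn : (j - x).toNat using Nat.strong_induction_on generalizing p x with
  | _ n ih =>
  obtain ⟨y, hxy, hyj, hy, hmax⟩ := hH.exists_greatest_adj hxj
  have hconvex := hH.two_mul_le hf hpx hxy h hy (hcover p y hip hpx hxy hyj) (hp.trans hpx'.le)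
  rcases hyj.eq_or_lt with rfl | hyj'
  · linarith
  refine ih _ (by omega) (hip.trans hpx.le) hxy hyj' hy (hp.trans hpx'.le) (by linarith) ?_ rfl
  intro z w hz hzy hyw hwj
  rcases lt_trichotomy z x with hzx | rfl | hxz
  · exact hcover z w hz hzx (hxy.trans hyw) hwj
  · exact hmax w hyw hwj
  · exact hH.not_adj_of_adj hxz hzy hyw hy

theorem two_le_of_not_adj (hH : IsBoundaryGraph H q) (hf : IsHillSolution q f) (hi : f i = 0)
    (hsucc : f (i + 1) = 1) (hij : i < j) (h : ¬ H.Adj i j) : 2 ≤ f j := by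
  obtain ⟨y, hiy, hyj, hy, hmax⟩ := hH.exists_greatest_adj hij
  have hlt : f i < f y := by
    rw [hi, hH.eq_one_of_adj hf hi hsucc hiy hy]
    exact one_pos
  refine hH.two_le_of_path hf le_rfl hiy (hyj.lt_of_ne ?_) hy hi.ge hlt ?_
  · rintro rfl
    exact h hy
  · intro z w hz hzy hyw hwj
    rcases hz.eq_or_lt with rfl | hiz
    · exact hmax w hyw hwj
    · exact hH.not_adj_of_adj hiz hzy hyw hy

theorem eq_one_iff_adj (hH : IsBoundaryGraph H q) (hf : IsHillSolution q f) (hi : f i = 0)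
    (hsucc : f (i + 1) = 1) (hij : i < j) : f j = 1 ↔ H.Adj i j := by
  refine ⟨fun h => ?_, hH.eq_one_of_adj hf hi hsucc hij⟩
  by_contra hn
  have := hH.two_le_of_not_adj hf hi hsucc hij hn
  omega

theorem one_le (hH : IsBoundaryGraph H q) (hf : IsHillSolution q f) (hi : f i = 0)
    (hsucc : f (i + 1) = 1) (hij : i < j) : 1 ≤ f j := by
  by_cases h : H.Adj i j
  · exact (hH.eq_one_of_adj hf hi hsucc hij h).ge
  · exact one_le_two.trans (hH.two_le_of_not_adj hf hi hsucc hij h)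

end IsBoundaryGraph

namespace IsInfiniteFrieze

variable {t t' : ℤ → ℤ → ℤ} {i j : ℤ}

theorem eq_of_le (ht : IsInfiniteFrieze t) (ht' : IsInfiniteFrieze t')
    (hquiddity : ∀ i, t (i - 1) (i + 1) = t' (i - 1) (i + 1)) (hij : i ≤ j) :
    t i j = t' i j := by
  induction hn : (j - i).toNat using Nat.strong_induction_on generalizing i j with
  | _ n ih =>
  obtain rfl | rfl | rfl | hlt : j = i ∨ j = i + 1 ∨ j = i + 1 + 1 ∨ i + 1 < j - 1 := by omega
  · rw [ht.diag, ht'.diag]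
  · rw [ht.one, ht'.one]
  · simpa using hquiddity (i + 1)
  · have hdet := ht.unimodular i (j - 1)
    have hdet' := ht'.unimodular i (j - 1)
    rw [sub_add_cancel] at hdet hdet'
    rw [ih _ (by omega) (by omega : i ≤ j - 1) rfl, ih _ (by omega) (by omega : i + 1 ≤ j) rfl,
      ih _ (by omega) hlt.le rfl] at hdet
    have hne : t' (i + 1) (j - 1) ≠ 0 := (one_pos.trans_le (ht'.pos _ _ hlt)).ne'
    exact mul_right_cancel₀ hne (sub_right_injective (hdet.trans hdet'.symm))

theorem ext_of_quiddity (ht : IsInfiniteFrieze t) (ht' : IsInfiniteFrieze t')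
    (hquiddity : ∀ i, t (i - 1) (i + 1) = t' (i - 1) (i + 1)) : t = t' := by
  funext i j
  rcases le_total i j with hij | hji
  · exact ht.eq_of_le ht' hquiddity hij
  · rw [ht.antisymm, ht'.antisymm, ht.eq_of_le ht' hquiddity hji]

end IsInfiniteFrieze

theorem IsBoundaryGraph.exists_isInfiniteFrieze {H : SimpleGraph ℤ} {q : ℤ → ℤ}
    (hH : IsBoundaryGraph H q) : ∃ t, IsInfiniteFrieze t ∧ (∀ i, t (i - 1) (i + 1) = q i) ∧
      ∀ i j, i < j → (t i j = 1 ↔ H.Adj i j) := by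
  obtain ⟨t, hHill, hdiag, hone, hantisymm, hunimodular⟩ := exists_unimodular_isHillSolution q
  refine ⟨t, ⟨hdiag, fun i _ => hH.one_le (hHill i) (hdiag i) (hone i), hone, hantisymm,
    hunimodular⟩, fun i => ?_, fun i _ => hH.eq_one_iff_adj (hHill i) (hdiag i) (hone i)⟩
  have hone' := hone (i - 1)
  have hi := hHill (i - 1) i
  rw [sub_add_cancel] at hone'
  rwa [hdiag, hone', add_zero, mul_one] at hi

section Triangulation

variable {M₂ : Set ℤ} {T : Set (Sym2 (MarkedPoint M₂))} {P Q : MarkedPoint M₂} {i j : ℤ}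

namespace IsTriangulation

theorem adj_of_mem (hT : IsTriangulation T) (h : s(P, Q) ∈ T) : (sideGraph T).Adj P Q := by
  obtain ⟨R, S, hRS, hne, -⟩ := hT.prop.1 _ h
  refine ⟨fun hPQ => hne ?_, Or.inr h⟩
  rcases Sym2.eq_iff.1 hRS with ⟨rfl, rfl⟩ | ⟨rfl, rfl⟩
  · exact hPQ
  · exact hPQ.symm

theorem mem_of_compatible (hT : IsTriangulation T) (hne : P ≠ Q) (hPQ : ¬ IsBoundarySegment P Q)
    (h : ∀ e ∈ T, e ≠ s(P, Q) → Compatible s(P, Q) e) : s(P, Q) ∈ T :=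
  hT.mem_of_prop_insert ⟨forall_mem_insert.2 ⟨⟨P, Q, rfl, hne, hPQ⟩, hT.prop.1⟩,
    hT.prop.2.insert fun e he hne' => ⟨h e he hne'.symm, (h e he hne'.symm).symm⟩⟩

theorem isMaximalNoncrossing (hT : IsTriangulation T) :
    IsMaximalNoncrossing MarkedPoint.coord (sideGraph T) where
  injective := coord_injective
  not_separates := by
    rintro P Q R S ⟨-, hPQ | hPQ⟩ ⟨-, hRS | hRS⟩ hsep
    · exact hPQ.not_separates R S hsep
    · exact hPQ.not_separates R S hsep
    · exact hRS.not_separates P Q (separates_comm.1 hsep)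
    · by_cases h : s(P, Q) = s(R, S)
      · rcases Sym2.eq_iff.1 h with ⟨rfl, rfl⟩ | ⟨rfl, rfl⟩ <;> simp [Separates] at hsep
      · exact not_compatible_of_separates hsep (hT.prop.2 hPQ hRS h)
  exists_separates := by
    intro P Q hne hadj
    by_contra! hsep
    refine hadj (hT.adj_of_mem (hT.mem_of_compatible hne (fun h => hadj ⟨hne, Or.inl h⟩) ?_))
    rintro ⟨R, S⟩ hRS hne'
    exact compatible_of_not_separates hne (hT.adj_of_mem hRS).ne hne'.symm
      (hsep R S (hT.adj_of_mem hRS))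

end IsTriangulation

theorem isBoundaryChain_lower :
    IsBoundaryChain MarkedPoint.coord (MarkedPoint.lower : ℤ → MarkedPoint M₂) where
  strictMono := fun _ _ h => coord_lower_lt.2 h
  mem_range := by
    rintro i j (k | u) hi -
    · exact mem_range_self k
    · exact absurd hi ((coord_upper_neg u).trans (coord_lower_pos i)).not_gt

theorem isBoundarySegment_lower_lower :
    IsBoundarySegment (.lower i : MarkedPoint M₂) (.lower j) ↔ j = i + 1 ∨ j = i - 1 := by
  simp only [IsBoundarySegment, Order.covBy_iff_add_one_eq]
  omega

theorem sideGraph_adj_lower_lower (hij : i < j) :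
    (sideGraph T).Adj (.lower i) (.lower j) ↔
      j = i + 1 ∨ s(MarkedPoint.lower i, MarkedPoint.lower j) ∈ T := by
  have hne : (MarkedPoint.lower i : MarkedPoint M₂) ≠ .lower j := by simpa using hij.ne
  refine (and_iff_right hne).trans (or_congr_left ?_)
  rw [isBoundarySegment_lower_lower]
  omega

theorem IsAdmissible.finite_neighborSet (hadm : IsAdmissible T) (i : ℤ) :
    ((sideGraph T).neighborSet (.lower i)).Finite := by
  have harcs : {Q | s(MarkedPoint.lower i, Q) ∈ T}.Finite :=
    ((hadm i).preimage (f := fun Q => s(MarkedPoint.lower i, Q))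
      fun Q _ R _ h => Sym2.congr_right.1 h).subset fun Q hQ => ⟨hQ, Sym2.mem_mk_left _ _⟩
  refine ((toFinite {.lower (i + 1), .lower (i - 1)}).union harcs).subset ?_
  rintro (j | u) ⟨-, hseg | hmem⟩
  · exact Or.inl ((isBoundarySegment_lower_lower.1 hseg).imp (congrArg _) (congrArg _))
  · exact Or.inr hmem
  · exact hseg.elim
  · exact Or.inr hmem

theorem IsTriangulation.isBoundaryGraph (hT : IsTriangulation T) (hadm : IsAdmissible T) :
    IsBoundaryGraph ((sideGraph T).comap MarkedPoint.lower)
      fun i => (trianglesAt T (.lower i)).ncard :=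
  hT.isMaximalNoncrossing.isBoundaryGraph isBoundaryChain_lower hadm.finite_neighborSet

theorem exists_isPhi (hT : IsTriangulation T) (hadm : IsAdmissible T) :
    ∃ t, IsPhi T t ∧ ∀ i j, i < j → (t i j = 1 ↔ (sideGraph T).Adj (.lower i) (.lower j)) := by
  obtain ⟨t, ht, hquiddity, hone⟩ := (hT.isBoundaryGraph hadm).exists_isInfiniteFrieze
  exact ⟨t, ⟨ht, fun i => ⟨finite_trianglesThrough (hadm.finite_neighborSet i), hquiddity i⟩⟩, hone⟩

theorem IsPhi.unique {t t' : ℤ → ℤ → ℤ} (ht : IsPhi T t) (ht' : IsPhi T t') : t = t' :=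
  ht.1.ext_of_quiddity ht'.1 fun i => (ht.2 i).2.trans (ht'.2 i).2.symm

end Triangulation

end InfiniteStrip

open InfiniteStrip in
theorem corollary2p9_general (M₂ : Set ℤ) (T : Set (Sym2 (MarkedPoint M₂)))
    (hT : IsTriangulation T) (hadm : IsAdmissible T) :
    (∃! t : ℤ → ℤ → ℤ, IsPhi T t) ∧
      ∀ t : ℤ → ℤ → ℤ, IsPhi T t → ∀ i j : ℤ, i ≤ j →
        (t i j = 1 ↔ j = i + 1 ∨ s(MarkedPoint.lower i, MarkedPoint.lower j) ∈ T) := by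
  obtain ⟨t, ht, hone⟩ := exists_isPhi hT hadm
  refine ⟨⟨t, ht, fun t' ht' => ht'.unique ht⟩, fun t' ht' i j hij => ?_⟩
  obtain rfl := ht'.unique ht
  rcases hij.eq_or_lt with rfl | hlt
  · rw [ht.1.diag]
    exact iff_of_false zero_ne_one fun h => h.elim (by omega) fun h => (hT.adj_of_mem h).ne rfl
  · rw [hone i j hlt, sideGraph_adj_lower_lower hlt]

open InfiniteStrip in
/-- The first conjunct says that `Φ(T)` is well defined. -/
theorem corollary2p9 (M₂ : Set ℤ) (T : Set (Sym2 (MarkedPoint M₂)))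
    (hT : IsTriangulation T) (hadm : IsAdmissible T)
    (hspecial : ∀ u : M₂, ¬ IsSpecial T (MarkedPoint.upper u)) :
    (∃! t : ℤ → ℤ → ℤ, IsPhi T t) ∧
      ∀ t : ℤ → ℤ → ℤ, IsPhi T t → ∀ i j : ℤ, i ≤ j →
        (t i j = 1 ↔ j = i + 1 ∨ s(MarkedPoint.lower i, MarkedPoint.lower j) ∈ T) :=
  corollary2p9_general M₂ T hT hadm
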